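/- Let $M$ be a matroid of rank $r$ on a finite ground set $S$ which is transversal with presentation $(A_1,\dots,A_r)$, $A_j\subseteq S$; that is, the bases of $M$ are the sets of elements of $S$ covered by the maximum matchings of the bipartite graph on $S\sqcup[r]$ with edges $(x,j)$, $x\in A_j$. For $I\subseteq[r]$ let $l_I$ be the number of $x\in S$ with $\{j : x\in A_j\}=I$. For $J\subseteq\{0,1,\dots,r\}$ let $\Delta_J\subset\mathbb R^r$ be the convex hull of the points $e_j$, $j\in J$, where $e_0$ is the origin and $e_1,\dots,e_r$ are the unit vectors. The transversalhedron is the Minkowski sum $P_M=\sum_{I\subseteq[r]} l_I\,\Delta_{\{0\}\cup I}$; let $I_1,\dots,I_m$ be the sets $I$ with $l_I>0$. A Minkowski cell of a Minkowski sum $P_1+\dots+P_m$ of dimension $d$ is a polytope $B_1+\dots+B_m$ of dimension $d$ (given with its summands) where each $B_i$ is the convex hull of a nonempty set of vertices of $P_i$. A fine mixed subdivision is a set of Minkowski cells, pairwise distinct as polytopes, whose union is $P_1+\dots+P_m$, such that any two cells intersect in a (possibly empty) common face, and such that in each cell all $B_i$ are simplices with $\sum_i\dim B_i=d$. For $P_M=\sum_i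 l_{I_i}\Delta_{\{0\}\cup I_i}$, the cells of a fine mixed subdivision have the form $\Pi_{\mathcal J}=\sum_i l_{I_i}\Delta_{J_i}$ with $\emptyset\ne J_i\subseteq\{0\}\cup I_i$, and the bipartite graph $G_{\mathcal J}$ with left vertices $1,\dots,m$, right vertices $0,1,\dots,r$ and edges $(i,j)$ for $j\in J_i$ is a tree. If $0\in J_i$ put $t_i=0$; if $0\notin J_i$ let $t_i$ be the unique element of $J_i$ that is joined to the right vertex $0$ by a path of $G_{\mathcal J}$ not passing through the left vertex $i$. A lattice point of $l_{I_i}\Delta_{J_i}$ is good if it lies on none of the faces $l_{I_i}\Delta_{J_i\setminus\{j\}}$ with $j\in J_i\setminus\{t_i\}$. A lattice point of $\Pi_{\mathcal J}$ is good if it is a sum $p_1+\dots+p_m$ in which each $p_i$ is a good lattice point of $l_{I_i}\Delta_{J_i}$. Proposition. Fix any fine mixed subdivision of $P_M$, and let $p\in\mathbb Z^r$ be a lattice point of $P_M$ that lies on none of the coordinate hyperplanes $x_k=0$, $k=1,\dots,r$. Then $p$ is a good lattice point of exactly one cell of the subdivision. -/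

import Mathlib

open scoped Pointwise

/-! ### Mixed subdivisions of Minkowski sums -/

namespace MixedSubdivision

variable {E : Type*} [AddCommGroup E] [Module ℝ E]

/-- The dimension of a (nonempty) polytope: the dimension of its affine span. -/
noncomputable def dim (X : Set E) : ℕ :=
  Module.finrank ℝ (vectorSpan ℝ X)

/-- A simplex: the convex hull of a nonempty affinely independent set of points. -/
def IsSimplex (X : Set E) : Prop :=
  ∃ V : Set E, V.Nonempty ∧ AffineIndependent ℝ ((↑) : V → E) ∧ X = convexHull ℝ V

variable {ι : Type*} [Fintype ι]

/-- `B = (B i)` describes a Minkowski cell `∑ i, B i` of `∑ i, P i`: every `B i` is the convex hull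
of a (nonempty) subset of the vertices of `P i`, and the sum has the full dimension. -/
structure IsMinkowskiCell (P B : ι → Set E) : Prop where
  hull : ∀ i, ∃ V : Set E, V.Nonempty ∧ V ⊆ (P i).extremePoints ℝ ∧ B i = convexHull ℝ V
  full_dim : dim (∑ i, B i) = dim (∑ i, P i)

variable [TopologicalSpace E]

/-- A mixed subdivision of the Minkowski sum `∑ i, P i`, as a set of Minkowski cells
`B = (B i)`, each given with its summands. Faces include the empty face. Different members of
the subdivision are different polytopes. -/
structure IsMixedSubdivision (P : ι → Set E) (S : Set (ι → Set E)) : Prop where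
  cell : ∀ B ∈ S, IsMinkowskiCell P B
  cover : (⋃ B ∈ S, ∑ i, B i) = ∑ i, P i
  common_face : ∀ B ∈ S, ∀ B' ∈ S,
    IsExposed ℝ (∑ i, B i) ((∑ i, B i) ∩ ∑ i, B' i) ∧
      IsExposed ℝ (∑ i, B' i) ((∑ i, B i) ∩ ∑ i, B' i)
  distinct : Set.InjOn (fun B : ι → Set E => ∑ i, B i) S

/-- A fine mixed subdivision: in each cell all summands are simplices, and their dimensions add
up to the dimension of the Minkowski sum. -/
structure IsFineMixedSubdivision (P : ι → Set E) (S : Set (ι → Set E)) : Prop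
    extends IsMixedSubdivision P S where
  simplex : ∀ B ∈ S, ∀ i, IsSimplex (B i)
  sum_dim : ∀ B ∈ S, ∑ i, dim (B i) = dim (∑ i, P i)

end MixedSubdivision

/-! ### Transversal matroids -/

namespace TransversalMatroid

variable {α : Type*} [DecidableEq α] {r : ℕ}

/-- A matching, as a set of edges `(x, j)`, of the bipartite graph of the family `A`, in which
`x` and `j` are joined when `x ∈ A j`. -/
def IsMatching (A : Fin r → Finset α) (T : Finset (α × Fin r)) : Prop :=
  (∀ e ∈ T, e.1 ∈ A e.2) ∧
    Set.InjOn Prod.fst (T : Set (α × Fin r)) ∧ Set.InjOn Prod.snd (T : Set (α × Fin r))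

/-- A matching with the largest possible number of edges. -/
def IsMaximumMatching (A : Fin r → Finset α) (T : Finset (α × Fin r)) : Prop :=
  IsMatching A T ∧ ∀ T', IsMatching A T' → T'.card ≤ T.card

/-- `A` is a presentation of the matroid `M` on the ground set `α`: the bases of `M` are the sets
of elements of `α` covered by the maximum matchings. -/
def IsPresentation (M : Matroid α) (A : Fin r → Finset α) : Prop :=
  M.E = Set.univ ∧
    ∀ B : Set α, M.IsBase B ↔ ∃ T, IsMaximumMatching A T ∧ B = ↑(T.image Prod.fst)

/-- The type of an element `x`: the set of all `j` with `x ∈ A j`. -/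
def type (A : Fin r → Finset α) (x : α) : Finset (Fin r) :=
  Finset.univ.filter fun j => x ∈ A j

/-- The number `l_I` of elements of type `I`. -/
def mult [Fintype α] (A : Fin r → Finset α) (I : Finset (Fin r)) : ℕ :=
  (Finset.univ.filter fun x => type A x = I).card

end TransversalMatroid

/-! ### Transversalhedra and good lattice points -/

namespace Transversalhedron

open TransversalMatroid

variable {r : ℕ}

/-- The points indexed by `{0, 1, …, r}`: the origin for `0`, and the unit vectors otherwise. -/
def vertex (j : Fin (r + 1)) : Fin r → ℝ :=
  Fin.cases 0 (fun k => Pi.single k 1) j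

/-- The simplex `Δ_J` in `ℝ^r` for `J ⊆ {0, 1, …, r}`. -/
def simplex (J : Set (Fin (r + 1))) : Set (Fin r → ℝ) :=
  convexHull ℝ (vertex '' J)

/-- The subset `{0} ∪ I` of `{0, 1, …, r}`. -/
def withZero (I : Finset (Fin r)) : Set (Fin (r + 1)) :=
  insert 0 (Fin.succ '' (I : Set (Fin r)))

/-- A point of `ℝ^r` with integer coordinates. -/
def IsLatticePoint (x : Fin r → ℝ) : Prop :=
  ∀ k, ∃ z : ℤ, x k = z

variable {α : Type*} [DecidableEq α] [Fintype α]

/-- The transversalhedron, the Minkowski sum of all `l_I Δ_{{0} ∪ I}`. -/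
def transversalhedron (A : Fin r → Finset α) : Set (Fin r → ℝ) :=
  ∑ I : Finset (Fin r), (mult A I : ℝ) • simplex (withZero I)

/-- The sets `I ⊆ {1, …, r}` that occur as the type of an element. -/
abbrev OccurringType (A : Fin r → Finset α) : Type :=
  {I : Finset (Fin r) // 0 < mult A I}

/-- The nontrivial Minkowski summands `l_I Δ_{{0} ∪ I}` of the transversalhedron. -/
def summand (A : Fin r → Finset α) (I : OccurringType A) : Set (Fin r → ℝ) :=
  (mult A I.1 : ℝ) • simplex (withZero I.1)

/-- For a cell with summands `B I`, the set `J_I ⊆ {0} ∪ I` with `B I = l_I Δ_{J_I}`. -/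
def labels (A : Fin r → Finset α) (B : OccurringType A → Set (Fin r → ℝ)) (I : OccurringType A) :
    Set (Fin (r + 1)) :=
  {j | j ∈ withZero I.1 ∧ (mult A I.1 : ℝ) • vertex j ∈ B I}

/-- The bipartite graph `G_J` with an edge between the left vertex `i` and the right vertex `j`
whenever `j ∈ J i`. -/
def graph {ι : Type*} (J : ι → Set (Fin (r + 1))) : SimpleGraph (ι ⊕ Fin (r + 1)) :=
  SimpleGraph.fromRel fun a b => ∃ i, ∃ j ∈ J i, a = Sum.inl i ∧ b = Sum.inr j

/-- `t ∈ J i` is joined to the right vertex `0` by a path of `G_J` that does not pass through `i`.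
When `G_J` is a spanning tree, there is exactly one such `t` for each `i`, the element `t_{i,0}`. -/
def IsRoot {ι : Type*} (J : ι → Set (Fin (r + 1))) (i : ι) (t : Fin (r + 1)) : Prop :=
  t ∈ J i ∧ ∃ w : (graph J).Walk (Sum.inr t) (Sum.inr 0), w.IsPath ∧ Sum.inl i ∉ w.support

/-- `q` is a good lattice point of `c Δ_{J i}`: it avoids the faces `c Δ_{J i \ {j}}` for all
`j ∈ J i` except `0` (if `0 ∈ J i`), or except `t_{i,0}` (if `0 ∉ J i`). -/
def IsGoodSummandPoint {ι : Type*} (J : ι → Set (Fin (r + 1))) (i : ι) (c : ℝ)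
    (q : Fin r → ℝ) : Prop :=
  IsLatticePoint q ∧ q ∈ c • simplex (J i) ∧
    (0 ∈ J i → ∀ j ∈ J i, j ≠ 0 → q ∉ c • simplex (J i \ {j})) ∧
    (0 ∉ J i → ∀ j ∈ J i, ¬ IsRoot J i j → q ∉ c • simplex (J i \ {j}))

/-- `p` is a good lattice point of the cell with summands `B I = l_I Δ_{J_I}`: it is the sum of
good lattice points of the summands. -/
def IsGoodPoint (A : Fin r → Finset α) (B : OccurringType A → Set (Fin r → ℝ))
    (p : Fin r → ℝ) : Prop :=
  ∃ q : OccurringType A → Fin r → ℝ, p = ∑ I, q I ∧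
    ∀ I, IsGoodSummandPoint (labels A B) I (mult A I.1 : ℝ) (q I)

end Transversalhedron

/-!
The graph of a cell is a tree, so every point has unique (possibly negative) barycentric coordinates
in the cell: they are carried by the flows along the paths of the tree to the right vertex `0`. A
lattice point has integral coordinates.

Move `p` to `y = p - (1, …, 1) / (r + 1)`. The coordinates change by `b / (r + 1)` with integers `b`
such that `|b| ≤ r`, and `b < 0` exactly at the edges `(i, j)` with `j ≠ t_i`, since these are the
edges by which the path from some right vertex to `0` enters the left vertex `i`. Hence `y` lies in
the cell if and only if the coordinates of `p` are nonnegative and do not vanish at these edges,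
that is, if and only if `p` is good for the cell. In this case the coordinates of `y` at all edges
are even positive, so `y` lies on no proper face of the cell. As the cells cover `P_M` and meet in
common faces, `y` is contained in exactly one of them.
-/

namespace Transversalhedron

open TransversalMatroid MixedSubdivision SimpleGraph

/-! ### Flows along paths of a tree -/

section NetFlow

variable {V : Type*} [DecidableEq V] {G : SimpleGraph V} {u v x y z : V}

/-- The antisymmetric flow of one unit from `u` to `v`. -/
def unitFlow (u v x y : V) : ℤ :=
  (if x = u ∧ y = v then 1 else 0) - (if x = v ∧ y = u then 1 else 0)

/-- The antisymmetric flow of a walk: `netFlow w x y` is the number of times `w` steps from `x`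
to `y` minus the number of times it steps from `y` to `x`. -/
def netFlow {u v : V} : G.Walk u v → V → V → ℤ
  | .nil => 0
  | .cons (u := u) (v := v) _ w => unitFlow u v + netFlow w

lemma unitFlow_antisymm (u v x y : V) : unitFlow u v y x = -unitFlow u v x y := by
  simp only [unitFlow, and_comm, neg_sub]

lemma unitFlow_eq_zero_of_ne (hx : x ≠ u) (hy : y ≠ u) (v : V) : unitFlow u v x y = 0 := by
  simp [unitFlow, hx, hy]

lemma abs_unitFlow_le_one (u v x y : V) : |unitFlow u v x y| ≤ 1 := by
  unfold unitFlow
  split_ifs <;> simp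

lemma sum_unitFlow [Fintype V] (u v x : V) :
    ∑ y, unitFlow u v x y = (if x = u then 1 else 0) - if x = v then 1 else 0 := by
  simp only [unitFlow, Finset.sum_sub_distrib, ite_and]
  congr 1 <;> split_ifs <;> simp

lemma netFlow_cons (h : G.Adj u v) (w : G.Walk v z) (x y : V) :
    netFlow (.cons h w) x y = unitFlow u v x y + netFlow w x y := rfl

lemma netFlow_antisymm (w : G.Walk u v) (x y : V) : netFlow w y x = -netFlow w x y := by
  induction w with
  | nil => rfl
  | cons h w ih => rw [netFlow_cons, netFlow_cons, ih, unitFlow_antisymm, neg_add]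

lemma netFlow_eq_zero_of_not_adj (w : G.Walk u v) (h : ¬ G.Adj x y) : netFlow w x y = 0 := by
  induction w with
  | nil => rfl
  | @cons u v _ huv w ih =>
    have hfwd : ¬ (x = u ∧ y = v) := fun ⟨hx, hy⟩ ↦ h (hx ▸ hy ▸ huv)
    have hbwd : ¬ (x = v ∧ y = u) := fun ⟨hx, hy⟩ ↦ h (hx ▸ hy ▸ huv.symm)
    simp [netFlow_cons, unitFlow, hfwd, hbwd, ih]

lemma sum_netFlow [Fintype V] (w : G.Walk u v) (x : V) :
    ∑ y, netFlow w x y = (if x = u then 1 else 0) - if x = v then 1 else 0 := by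
  induction w with
  | nil => simp [netFlow]
  | cons h w ih => simp only [netFlow_cons, Finset.sum_add_distrib, sum_unitFlow, ih]; ring

lemma netFlow_eq_zero_of_notMem_support (w : G.Walk u v) (hx : x ∉ w.support) (y : V) :
    netFlow w x y = 0 := by
  induction w with
  | nil => rfl
  | @cons u v _ h w ih =>
    rw [Walk.support_cons, List.mem_cons, not_or] at hx
    have hxv : x ≠ v := fun e ↦ hx.2 (e ▸ w.start_mem_support)
    simp [netFlow_cons, unitFlow, ih hx.2, hx.1, hxv]

lemma netFlow_tail_eq_zero {h : G.Adj u v} {w : G.Walk v z} (hw : (Walk.cons h w).IsPath)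
    (hxy : x = u ∨ y = u) : netFlow w x y = 0 := by
  have hu := ((Walk.cons_isPath_iff h w).1 hw).2
  rcases hxy with rfl | rfl
  · exact netFlow_eq_zero_of_notMem_support w hu y
  · rw [netFlow_antisymm, netFlow_eq_zero_of_notMem_support w hu x, neg_zero]

lemma abs_netFlow_le_one {w : G.Walk u v} (hw : w.IsPath) (x y : V) : |netFlow w x y| ≤ 1 := by
  induction w with
  | nil => simp [netFlow]
  | @cons u v _ h w ih =>
    rw [netFlow_cons]
    by_cases hxy : x = u ∨ y = u
    · rw [netFlow_tail_eq_zero hw hxy, add_zero]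
      exact abs_unitFlow_le_one u v x y
    · rw [not_or] at hxy
      rw [unitFlow_eq_zero_of_ne hxy.1 hxy.2, zero_add]
      exact ih hw.of_cons

lemma exists_isPath_of_netFlow_pos {w : G.Walk u v} (hw : w.IsPath) (h : 0 < netFlow w x y) :
    ∃ w' : G.Walk y v, w'.IsPath ∧ x ∉ w'.support := by
  induction w with
  | nil => simp [netFlow] at h
  | @cons u v _ huv w ih =>
    by_cases hxy : x = u ∧ y = v
    · obtain ⟨rfl, rfl⟩ := hxy
      exact ⟨w, (Walk.cons_isPath_iff huv w).1 hw⟩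
    · refine ih hw.of_cons ?_
      have hle : unitFlow u v x y ≤ 0 := by
        rw [unitFlow, if_neg hxy]
        split_ifs <;> simp
      rw [netFlow_cons] at h
      lia

lemma netFlow_eq_one_of_isPath_cons {h : G.Adj u v} {w : G.Walk v z}
    (hw : (Walk.cons h w).IsPath) : netFlow (.cons h w) u v = 1 := by
  rw [netFlow_cons, netFlow_tail_eq_zero hw (.inl rfl)]
  simp [unitFlow, h.ne]

end NetFlow

section Acyclic

variable {V : Type*} {G : SimpleGraph V} {x y z : V}

lemma isPath_unique (hG : G.IsAcyclic) {p q : G.Walk x y} (hp : p.IsPath) (hq : q.IsPath) :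
    p = q :=
  congrArg Subtype.val ((hG.subsingleton_path x y).elim ⟨p, hp⟩ ⟨q, hq⟩)

lemma eq_cons_or_eq_cons_of_adj (hG : G.IsAcyclic) (h : G.Adj x y) {p : G.Walk x z}
    {q : G.Walk y z} (hp : p.IsPath) (hq : q.IsPath) :
    p = .cons h q ∨ q = .cons h.symm p := by
  by_cases hx : x ∈ q.support
  · have hy : y ∉ p.support := by
      simpa using hG.ne_mem_support_of_support_of_adj_of_isPath hq.reverse hp.reverse h.symm
        (by simpa using hx)
    exact .inr (isPath_unique hG hq (hp.cons hy))
  · exact .inl (isPath_unique hG hp (hq.cons hx))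

lemma netFlow_sub_netFlow_of_adj [DecidableEq V] (hG : G.IsAcyclic) (h : G.Adj x y)
    {p : G.Walk x z} {q : G.Walk y z} (hp : p.IsPath) (hq : q.IsPath) :
    netFlow p - netFlow q = unitFlow x y := by
  rcases eq_cons_or_eq_cons_of_adj hG h hp hq with rfl | rfl
  · exact add_sub_cancel_right _ _
  · ext u v
    simp only [Pi.sub_apply, netFlow_cons, unitFlow]
    ring

end Acyclic

section Graph

variable {r : ℕ} {ι : Type*} {J : ι → Set (Fin (r + 1))} {i : ι} {j s t : Fin (r + 1)}

lemma graph_adj_inl_inr : (graph J).Adj (.inl i) (.inr j) ↔ j ∈ J i := by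
  simp [graph]

lemma graph_not_adj_inl_inl {i' : ι} : ¬ (graph J).Adj (.inl i) (.inl i') := by
  simp [graph]

lemma graph_not_adj_inr_inr : ¬ (graph J).Adj (.inr s) (.inr t) := by
  simp [graph]

lemma natCard_edgeSet_graph [Fintype ι] (J : ι → Set (Fin (r + 1))) :
    Nat.card (graph J).edgeSet = ∑ i, (J i).ncard := by
  let edge (e : Σ i, J i) : (graph J).edgeSet :=
    ⟨s(.inl e.1, .inr e.2), graph_adj_inl_inr.2 e.2.2⟩
  have hedge : edge.Bijective := by
    constructor
    · rintro ⟨i, j, hj⟩ ⟨i', j', hj'⟩ h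
      obtain ⟨rfl, rfl⟩ : i = i' ∧ j = j' := by simpa [edge] using congrArg Subtype.val h
      rfl
    · rintro ⟨e, he⟩
      induction e using Sym2.ind with | _ u v
      obtain ⟨-, ⟨i, j, hj, rfl, rfl⟩ | ⟨i, j, hj, rfl, rfl⟩⟩ :=
        (fromRel_adj _ _ _).1 ((graph J).mem_edgeSet.1 he)
      · exact ⟨⟨i, j, hj⟩, rfl⟩
      · exact ⟨⟨i, j, hj⟩, Subtype.ext Sym2.eq_swap⟩
  rw [← Nat.card_congr (Equiv.ofBijective edge hedge), Nat.card_sigma]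
  rfl

lemma isRoot_zero (h : 0 ∈ J i) : IsRoot J i 0 :=
  ⟨h, .nil, .nil, by simp⟩

lemma IsRoot.eq (hG : (graph J).IsAcyclic) (hs : IsRoot J i s) (ht : IsRoot J i t) : s = t := by
  obtain ⟨hsJ, p, hp, hip⟩ := hs
  obtain ⟨htJ, q, hq, hiq⟩ := ht
  simpa using congrArg Walk.snd <| isPath_unique hG
    (hp.cons (h := graph_adj_inl_inr.2 hsJ) hip) (hq.cons (h := graph_adj_inl_inr.2 htJ) hiq)

lemma eq_cons_of_not_isRoot (hG : (graph J).IsAcyclic) (hj : j ∈ J i) (hroot : ¬ IsRoot J i j)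
    {p : (graph J).Walk (.inr j) (.inr 0)} {q : (graph J).Walk (.inl i) (.inr 0)}
    (hp : p.IsPath) (hq : q.IsPath) : p = .cons (graph_adj_inl_inr.2 hj).symm q := by
  refine (eq_cons_or_eq_cons_of_adj hG (graph_adj_inl_inr.2 hj).symm hp hq).resolve_right ?_
  rintro rfl
  exact hroot ⟨hj, p, hp, ((Walk.cons_isPath_iff _ p).1 hq).2⟩

variable [DecidableEq ι] {u v : ι ⊕ Fin (r + 1)}

lemma sum_netFlow_inl [Finite ι] (w : (graph J).Walk u v) (i : ι) :
    ∑ j, netFlow w (.inl i) (.inr j) =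
      (if .inl i = u then 1 else 0) - if .inl i = v then 1 else 0 := by
  cases nonempty_fintype ι
  have hinl (i' : ι) : netFlow w (.inl i) (.inl i') = 0 :=
    netFlow_eq_zero_of_not_adj w graph_not_adj_inl_inl
  rw [← sum_netFlow w, Fintype.sum_sum_type]
  simp [hinl]

lemma sum_netFlow_inr [Fintype ι] (w : (graph J).Walk u v) (j : Fin (r + 1)) :
    ∑ i, netFlow w (.inl i) (.inr j) =
      (if .inr j = v then 1 else 0) - if .inr j = u then 1 else 0 := by
  have hinr (j' : Fin (r + 1)) : netFlow w (.inr j) (.inr j') = 0 :=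
    netFlow_eq_zero_of_not_adj w graph_not_adj_inr_inr
  rw [← neg_sub, ← sum_netFlow w, Fintype.sum_sum_type]
  simp [hinr, netFlow_antisymm w (.inr j)]

end Graph

section Coordinates

variable {r : ℕ} {ι : Type*} [Fintype ι] {J : ι → Set (Fin (r + 1))} {K : Type*}

/-- `a` is a family of barycentric coordinates, of arbitrary signs, of the point `x` with respect to
the Minkowski sum `∑ i, c i • simplex (J i)`: the point of the `i`-th summand has the coefficients
`a i`, which vanish outside `J i` and add up to `c i`. Coefficients in any `K` are allowed, so that
the notion covers integral coordinates and, for `c = 0`, the coordinates of directions. -/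
structure IsCoord [AddCommMonoid K] (J : ι → Set (Fin (r + 1))) (c : ι → K)
    (a : ι → Fin (r + 1) → K) (x : Fin r → K) : Prop where
  supp : ∀ i, ∀ j ∉ J i, a i j = 0
  row : ∀ i, ∑ j, a i j = c i
  col : ∀ k : Fin r, ∑ i, a i k.succ = x k

lemma IsCoord.add_smul [CommRing K] {c d : ι → K} {a b : ι → Fin (r + 1) → K} {x y : Fin r → K}
    (ha : IsCoord J c a x) (hb : IsCoord J d b y) (s : K) :
    IsCoord J (c + s • d) (a + s • b) (x + s • y) where
  supp i j hj := by simp [ha.supp i j hj, hb.supp i j hj]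
  row i := by simp [Finset.sum_add_distrib, ← Finset.mul_sum, ha.row, hb.row]
  col k := by simp [Finset.sum_add_distrib, ← Finset.mul_sum, ha.col, hb.col]

lemma IsCoord.intCast {c : ι → ℤ} {a : ι → Fin (r + 1) → ℤ} {x : Fin r → ℤ}
    (ha : IsCoord J c a x) :
    IsCoord J (fun i ↦ (c i : ℝ)) (fun i j ↦ (a i j : ℝ)) (fun k ↦ (x k : ℝ)) where
  supp i j hj := by simp [ha.supp i j hj]
  row i := by simp [← ha.row i]
  col k := by simp [← ha.col k]

section TreeCoord

variable [CommRing K] [DecidableEq ι]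

/-- The coordinates obtained by letting `c i` units flow from the left vertex `i` to the right
vertex `0`, and `x k` units from there to the right vertex `k`, along the given walks. -/
def treeCoord (P : ∀ v, (graph J).Walk v (.inr 0)) (c : ι → K) (x : Fin r → K) (i : ι)
    (j : Fin (r + 1)) : K :=
  ∑ i', c i' * netFlow (P (.inl i')) (.inl i) (.inr j) -
    ∑ k : Fin r, x k * netFlow (P (.inr k.succ)) (.inl i) (.inr j)

lemma isCoord_treeCoord (P : ∀ v, (graph J).Walk v (.inr 0)) (c : ι → K) (x : Fin r → K) :
    IsCoord J c (treeCoord P c x) x where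
  supp i j hj := by
    simp [treeCoord, netFlow_eq_zero_of_not_adj _ (mt graph_adj_inl_inr.1 hj)]
  row i := by
    simp only [treeCoord, Finset.sum_sub_distrib]
    rw [Finset.sum_comm, Finset.sum_comm (s := Finset.univ (α := Fin (r + 1)))]
    simp [← Finset.mul_sum, ← Int.cast_sum, sum_netFlow_inl]
  col k := by
    simp only [treeCoord, Finset.sum_sub_distrib]
    rw [Finset.sum_comm, Finset.sum_comm (t := Finset.univ (α := Fin r))]
    simp [← Finset.mul_sum, ← Int.cast_sum, sum_netFlow_inr]

lemma IsCoord.eq_treeCoord (hG : (graph J).IsAcyclic) {P : ∀ v, (graph J).Walk v (.inr 0)}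
    (hP : ∀ v, (P v).IsPath) {c : ι → K} {a : ι → Fin (r + 1) → K} {x : Fin r → K}
    (ha : IsCoord J c a x) : a = treeCoord P c x := by
  ext i j
  let f (v : ι ⊕ Fin (r + 1)) : K := netFlow (P v) (.inl i) (.inr j)
  have hedge (i' : ι) (j' : Fin (r + 1)) : a i' j' * (f (.inl i') - f (.inr j')) =
      if i = i' ∧ j = j' then a i' j' else 0 := by
    by_cases hj : j' ∈ J i'
    · have hflow := congrFun₂ (netFlow_sub_netFlow_of_adj hG (graph_adj_inl_inr.2 hj)
        (hP (.inl i')) (hP (.inr j'))) (.inl i) (.inr j)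
      rw [Pi.sub_apply, Pi.sub_apply] at hflow
      rw [← Int.cast_sub, hflow]
      simp [unitFlow]
    · simp [ha.supp i' j' hj]
  have hzero : f (.inr 0) = 0 := by
    simp [f, Walk.eq_nil_iff_nil.2 (Walk.isPath_iff_nil.1 (hP (.inr 0))), netFlow]
  calc a i j = ∑ i', ∑ j', a i' j' * (f (.inl i') - f (.inr j')) := by
        simp [hedge, ite_and]
    _ = ∑ i', (∑ j', a i' j') * f (.inl i') - ∑ j', (∑ i', a i' j') * f (.inr j') := by
        simp only [mul_sub, Finset.sum_sub_distrib, Finset.sum_mul]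
        rw [Finset.sum_comm (s := Finset.univ (α := Fin (r + 1)))]
    _ = treeCoord P c x i j := by
        simp only [ha.row, ha.col, Fin.sum_univ_succ (fun j' ↦ _ * f (.inr j')), hzero, mul_zero,
          zero_add]
        rfl

end TreeCoord

lemma existsUnique_isCoord [CommRing K] (hG : (graph J).IsTree) (c : ι → K) (x : Fin r → K) :
    ∃! a, IsCoord J c a x := by
  classical
  choose P hP using fun v ↦ (hG.connected v (.inr 0)).exists_isPath
  exact ⟨_, isCoord_treeCoord P c x, fun a ha ↦ ha.eq_treeCoord hG.isAcyclic hP⟩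

/-- `b` is the rate of change of the coordinates when a point moves in the direction
`-(1, …, 1)`, and it has the two properties on which the characterization of good points rests. -/
structure IsDrift (J : ι → Set (Fin (r + 1))) (b : ι → Fin (r + 1) → ℤ) : Prop where
  isCoord : IsCoord J 0 b (-1)
  abs_le : ∀ i j, |b i j| ≤ r
  neg_of_not_isRoot : ∀ i, ∀ j ∈ J i, ¬ IsRoot J i j → b i j < 0

lemma exists_isDrift (hG : (graph J).IsTree) : ∃ b, IsDrift J b := by
  classical
  choose P hP using fun v ↦ (hG.connected v (.inr 0)).exists_isPath
  have htree (i : ι) (j : Fin (r + 1)) : treeCoord P 0 (-1) i j =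
      ∑ k : Fin r, netFlow (P (.inr k.succ)) (.inl i) (.inr j) := by
    simp [treeCoord]
  refine ⟨_, isCoord_treeCoord P 0 (-1), fun i j ↦ ?_, fun i j hj hroot ↦ ?_⟩
  · rw [htree]
    calc _ ≤ ∑ k : Fin r, |netFlow (P (.inr k.succ)) (.inl i) (.inr j)| :=
          Finset.abs_sum_le_sum_abs _ _
      _ ≤ ∑ _k : Fin r, 1 := Finset.sum_le_sum fun k _ ↦ abs_netFlow_le_one (hP _) _ _
      _ = r := by simp
  · have hnonpos (k : Fin r) : netFlow (P (.inr k.succ)) (.inl i) (.inr j) ≤ 0 :=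
      not_lt.1 fun h ↦ hroot ⟨hj, exists_isPath_of_netFlow_pos (hP _) h⟩
    obtain ⟨k, rfl⟩ := Fin.exists_succ_eq.2 fun h : j = 0 ↦
      hroot (h ▸ isRoot_zero (h ▸ hj))
    have hcons := eq_cons_of_not_isRoot hG.isAcyclic hj hroot (hP _) (hP (.inl i))
    have hneg : netFlow (P (.inr k.succ)) (.inl i) (.inr k.succ) = -1 := by
      rw [netFlow_antisymm, hcons, netFlow_eq_one_of_isPath_cons (hcons ▸ hP _)]
    rw [htree]
    exact Finset.sum_neg' (fun k _ ↦ hnonpos k) ⟨k, Finset.mem_univ _, hneg.trans_lt (by simp)⟩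

section IsDrift

variable {b : ι → Fin (r + 1) → ℤ} {i : ι} {j t : Fin (r + 1)}

lemma IsDrift.nonpos_of_ne (hb : IsDrift J b) (hG : (graph J).IsAcyclic) (ht : IsRoot J i t)
    (hj : j ≠ t) : b i j ≤ 0 := by
  by_cases hmem : j ∈ J i
  · exact (hb.neg_of_not_isRoot i j hmem fun hroot ↦ hj (hroot.eq hG ht)).le
  · exact (hb.isCoord.supp i j hmem).le

lemma IsDrift.eq_neg_sum_erase (hb : IsDrift J b) (i : ι) (t : Fin (r + 1)) :
    b i t = -∑ j ∈ Finset.univ.erase t, b i j := by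
  rw [eq_neg_iff_add_eq_zero, Finset.add_sum_erase _ _ (Finset.mem_univ t)]
  exact hb.isCoord.row i

lemma IsDrift.nonneg_of_isRoot (hb : IsDrift J b) (hG : (graph J).IsAcyclic)
    (ht : IsRoot J i t) : 0 ≤ b i t := by
  rw [hb.eq_neg_sum_erase i t, neg_nonneg]
  exact Finset.sum_nonpos fun j hj ↦ hb.nonpos_of_ne hG ht (Finset.ne_of_mem_erase hj)

lemma IsDrift.pos_of_isRoot (hb : IsDrift J b) (hG : (graph J).IsAcyclic)
    (ht : IsRoot J i t) (hj : j ∈ J i) (hjt : j ≠ t) : 0 < b i t := by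
  rw [hb.eq_neg_sum_erase i t, neg_pos]
  exact Finset.sum_neg' (fun j hj ↦ hb.nonpos_of_ne hG ht (Finset.ne_of_mem_erase hj))
    ⟨j, by simp [hjt], hb.neg_of_not_isRoot i j hj fun hroot ↦ hjt (hroot.eq hG ht)⟩

end IsDrift

end Coordinates

/-! ### Minkowski sums of dilated simplices -/

section Simplex

variable {r : ℕ} {J : Set (Fin (r + 1))} {c : ℝ} {x y : Fin r → ℝ}

/-- The barycentric coordinates of `x` with respect to the points `vertex j`, homogenized to have
sum `c`. -/
def bary (c : ℝ) (x : Fin r → ℝ) : Fin (r + 1) → ℝ :=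
  Fin.cons (c - ∑ k, x k) x

lemma sum_bary (c : ℝ) (x : Fin r → ℝ) : ∑ j, bary c x j = c := by
  simp [bary, Fin.sum_univ_succ]

lemma bary_of_sum_eq {a : Fin (r + 1) → ℝ} (ha : ∑ j, a j = c) :
    bary c (fun k ↦ a k.succ) = a := by
  rw [bary, ← ha, Fin.sum_univ_succ, add_sub_cancel_right]
  exact Fin.cons_self_tail a

lemma sum_smul_vertex (a : Fin (r + 1) → ℝ) : ∑ j, a j • vertex j = fun k : Fin r ↦ a k.succ := by
  ext k
  simp [vertex, Fin.sum_univ_succ, Pi.single_apply]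

lemma bary_smul_vertex (c : ℝ) (j : Fin (r + 1)) : bary c (c • vertex j) = Pi.single j c := by
  rw [← bary_of_sum_eq (a := Pi.single j c) (c := c) (by simp), ← sum_smul_vertex]
  simp [Pi.single_apply, ite_smul]

lemma bary_add_smul {s t : ℝ} (hst : s + t = 1) (c : ℝ) (x y : Fin r → ℝ) :
    bary c (s • x + t • y) = s • bary c x + t • bary c y := by
  ext j
  refine Fin.cases ?_ (fun k ↦ rfl) j
  simp only [bary, Fin.cons_zero, Pi.add_apply, Pi.smul_apply, smul_eq_mul,
    Finset.sum_add_distrib, ← Finset.mul_sum]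
  linear_combination -c * hst

lemma smul_simplex_eq_convexHull (c : ℝ) (J : Set (Fin (r + 1))) :
    c • simplex J = convexHull ℝ ((fun j ↦ c • vertex j) '' J) := by
  rw [simplex, ← convexHull_smul, ← Set.image_smul, Set.image_image]

lemma mem_smul_simplex (hc : 0 < c) :
    x ∈ c • simplex J ↔ (∀ j, 0 ≤ bary c x j) ∧ ∀ j ∉ J, bary c x j = 0 := by
  constructor
  · rw [smul_simplex_eq_convexHull]
    refine fun hx ↦ convexHull_min (t := {x | (∀ j, 0 ≤ bary c x j) ∧ ∀ j ∉ J, bary c x j = 0})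
      ?_ ?_ hx
    · rintro _ ⟨j, hj, rfl⟩
      rw [Set.mem_ofPred_eq, bary_smul_vertex]
      have hnonneg : (0 : Fin (r + 1) → ℝ) ≤ Pi.single j c := Pi.single_nonneg.2 hc.le
      exact ⟨hnonneg, fun j' hj' ↦ by simp [(ne_of_mem_of_not_mem hj hj').symm]⟩
    · rintro x ⟨hx, hxJ⟩ y ⟨hy, hyJ⟩ s t hs ht hst
      rw [Set.mem_ofPred_eq, bary_add_smul hst]
      exact ⟨fun j ↦ add_nonneg (mul_nonneg hs (hx j)) (mul_nonneg ht (hy j)),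
        fun j hj ↦ by simp [hxJ j hj, hyJ j hj]⟩
  · rintro ⟨hnonneg, hJ⟩
    have hx : c⁻¹ • x = ∑ᶠ j, (c⁻¹ * bary c x j) • vertex j := by
      rw [finsum_eq_sum_of_fintype, sum_smul_vertex]
      rfl
    rw [Set.mem_smul_set_iff_inv_smul_mem₀ hc.ne', hx]
    refine (convex_convexHull ℝ _).finsum_mem (fun j ↦ by have := hnonneg j; positivity) ?_ ?_
    · rw [finsum_eq_sum_of_fintype, ← Finset.mul_sum, sum_bary, inv_mul_cancel₀ hc.ne']
    · refine fun j hj ↦ subset_convexHull ℝ _ ⟨j, ?_, rfl⟩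
      contrapose! hj
      rw [hJ j hj, mul_zero]

lemma mem_smul_simplex_diff_singleton (hc : 0 < c) (hx : x ∈ c • simplex J) (j : Fin (r + 1)) :
    x ∈ c • simplex (J \ {j}) ↔ bary c x j = 0 := by
  rw [mem_smul_simplex hc] at hx ⊢
  refine ⟨fun h ↦ h.2 j (by simp), fun hj ↦ ⟨hx.1, fun j' hj' ↦ ?_⟩⟩
  by_cases hmem : j' ∈ J
  · obtain rfl : j' = j := by simpa [hmem] using hj'
    exact hj
  · exact hx.2 j' hmem

lemma mem_smul_simplex_of_le (hc : 0 < c) (h0 : 0 ∈ J) (hx : x ∈ c • simplex J) (hy : 0 ≤ y)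
    (hyx : y ≤ x) : y ∈ c • simplex J := by
  rw [mem_smul_simplex hc] at hx ⊢
  refine ⟨Fin.cases ?_ hy, Fin.cases (absurd h0) fun k hk ↦ ?_⟩
  · exact (hx.1 0).trans (sub_le_sub_left (Finset.sum_le_sum fun k _ ↦ hyx k) c)
  · exact le_antisymm ((hyx k).trans_eq (hx.2 k.succ hk)) (hy k)

lemma affineIndependent_smul_vertex (hc : c ≠ 0) :
    AffineIndependent ℝ fun j : Fin (r + 1) ↦ c • (vertex j : Fin r → ℝ) := by
  rw [affineIndependent_iff_of_fintype]
  intro w hw hsum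
  rw [Finset.weightedVSub_eq_linear_combination _ hw] at hsum
  have hsucc : (fun k : Fin r ↦ w k.succ) = 0 := by
    simpa only [smul_comm _ c, ← Finset.smul_sum, smul_eq_zero_iff_right hc, sum_smul_vertex]
      using hsum
  suffices w = 0 from congrFun this
  rw [← bary_of_sum_eq hw, hsucc]
  ext j
  refine Fin.cases ?_ (fun k ↦ rfl) j
  simp [bary]

lemma dim_smul_simplex_add_one (hc : c ≠ 0) (hJ : J.Nonempty) :
    dim (c • simplex J) + 1 = J.ncard := by
  classical
  have := hJ.to_subtype
  have hJ' : AffineIndependent ℝ fun j : J ↦ c • (vertex j.1 : Fin r → ℝ) :=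
    (affineIndependent_smul_vertex hc).comp_embedding (.subtype _)
  rw [dim, smul_simplex_eq_convexHull, ← direction_affineSpan, affineSpan_convexHull,
    direction_affineSpan, Set.image_eq_range, hJ'.finrank_vectorSpan_add_one,
    Set.ncard_eq_toFinset_card', Set.toFinset_card]

end Simplex

section MinkowskiSum

variable {r : ℕ} {ι : Type*} [Fintype ι] {J : ι → Set (Fin (r + 1))} {c : ι → ℝ}
  {x y : Fin r → ℝ}

lemma isCoord_bary (hc : ∀ i, 0 < c i) {q : ι → Fin r → ℝ}
    (hq : ∀ i, q i ∈ c i • simplex (J i)) :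
    IsCoord J c (fun i ↦ bary (c i) (q i)) (∑ i, q i) where
  supp i := ((mem_smul_simplex (hc i)).1 (hq i)).2
  row i := sum_bary (c i) (q i)
  col k := (Finset.sum_apply k _ _).symm

lemma mem_sum_smul_simplex (hc : ∀ i, 0 < c i) :
    x ∈ ∑ i, c i • simplex (J i) ↔ ∃ a, IsCoord J c a x ∧ ∀ i j, 0 ≤ a i j := by
  rw [Set.mem_fintype_sum]
  constructor
  · rintro ⟨q, hq, rfl⟩
    exact ⟨_, isCoord_bary hc hq, fun i ↦ ((mem_smul_simplex (hc i)).1 (hq i)).1⟩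
  · rintro ⟨a, ha, hnonneg⟩
    refine ⟨fun i k ↦ a i k.succ, fun i ↦ ?_, ?_⟩
    · rw [mem_smul_simplex (hc i), bary_of_sum_eq (ha.row i)]
      exact ⟨hnonneg i, ha.supp i⟩
    · ext k
      rw [Finset.sum_apply, ha.col]

lemma IsCoord.mem_sum_smul_simplex_iff (hc : ∀ i, 0 < c i) (hG : (graph J).IsTree)
    {a : ι → Fin (r + 1) → ℝ} (ha : IsCoord J c a x) :
    x ∈ ∑ i, c i • simplex (J i) ↔ ∀ i j, 0 ≤ a i j := by
  rw [mem_sum_smul_simplex hc]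
  refine ⟨fun ⟨b, hb, hnonneg⟩ ↦ ?_, fun h ↦ ⟨a, ha, h⟩⟩
  rwa [(existsUnique_isCoord hG c x).unique ha hb]

lemma mem_sum_smul_simplex_of_le (hc : ∀ i, 0 < c i) (h0 : ∀ i, 0 ∈ J i)
    (hx : x ∈ ∑ i, c i • simplex (J i)) (hy : 0 ≤ y) (hyx : y ≤ x) :
    y ∈ ∑ i, c i • simplex (J i) := by
  rw [Set.mem_fintype_sum] at hx ⊢
  obtain ⟨q, hq, rfl⟩ := hx
  set x := ∑ i, q i with hx
  have hq0 (i : ι) (k : Fin r) : 0 ≤ q i k := ((mem_smul_simplex (hc i)).1 (hq i)).1 k.succ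
  have hratio (k : Fin r) : 0 ≤ y k / x k ∧ y k / x k ≤ 1 :=
    ⟨div_nonneg (hy k) ((hy k).trans (hyx k)), div_le_one_of_le₀ (hyx k) ((hy k).trans (hyx k))⟩
  refine ⟨fun i k ↦ q i k * (y k / x k), fun i ↦ ?_, ?_⟩
  · exact mem_smul_simplex_of_le (hc i) (h0 i) (hq i)
      (fun k ↦ mul_nonneg (hq0 i k) (hratio k).1)
      (fun k ↦ mul_le_of_le_one_right (hq0 i k) (hratio k).2)
  · ext k
    rw [Finset.sum_apply, ← Finset.sum_mul, ← Finset.sum_apply k Finset.univ q, ← hx]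
    exact mul_div_cancel_of_imp' fun h ↦ le_antisymm ((hyx k).trans_eq h) (hy k)

lemma vectorSpan_sum_smul_simplex_eq_top (hc : ∀ i, 0 < c i) (h0 : ∀ i, 0 ∈ J i)
    (hx : x ∈ ∑ i, c i • simplex (J i)) (hpos : ∀ k, 0 < x k) :
    vectorSpan ℝ (∑ i, c i • simplex (J i)) = ⊤ := by
  have hnonneg : 0 ≤ x := fun k ↦ (hpos k).le
  have hsingle (k : Fin r) :
      Pi.single k (1 : ℝ) ∈ vectorSpan ℝ (∑ i, c i • simplex (J i)) := by
    have hle : Pi.single k (x k) ≤ x := update_le_iff.2 ⟨le_rfl, fun k' _ ↦ hnonneg k'⟩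
    have hmem := vsub_mem_vectorSpan ℝ
      (mem_sum_smul_simplex_of_le hc h0 hx (Pi.single_nonneg.2 (hnonneg k)) hle)
      (mem_sum_smul_simplex_of_le hc h0 hx le_rfl hnonneg)
    simpa [← Pi.single_smul', (hpos k).ne'] using Submodule.smul_mem _ (x k)⁻¹ hmem
  rw [eq_top_iff, ← (Pi.basisFun ℝ (Fin r)).span_eq, Submodule.span_le]
  rintro _ ⟨k, rfl⟩
  simpa using hsingle k

lemma vectorSpan_sum_smul_simplex_le_ker (c : ι → ℝ) {f : (Fin r → ℝ) →ₗ[ℝ] ℝ} {φ : ι → ℝ}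
    (hf : ∀ i, ∀ j ∈ J i, f (vertex j) = φ i) :
    vectorSpan ℝ (∑ i, c i • simplex (J i)) ≤ LinearMap.ker f := by
  have hsimplex (i : ι) : simplex (J i) ⊆ f ⁻¹' {φ i} :=
    convexHull_min (by rintro _ ⟨j, hj, rfl⟩; exact hf i j hj)
      ((convex_singleton _).linear_preimage f)
  have hconst {x} (hx : x ∈ ∑ i, c i • simplex (J i)) : f x = ∑ i, c i * φ i := by
    obtain ⟨q, hq, rfl⟩ := (Set.mem_fintype_sum _ _).1 hx
    rw [map_sum]
    refine Finset.sum_congr rfl fun i _ ↦ ?_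
    obtain ⟨y, hy, hyq⟩ := hq i
    rw [← hyq, map_smul, hsimplex i hy, smul_eq_mul]
  rw [vectorSpan_def, Submodule.span_le]
  rintro _ ⟨x, hx, y, hy, rfl⟩
  simp [hconst hx, hconst hy]

lemma reachable_of_vectorSpan_eq_top
    (hspan : vectorSpan ℝ (∑ i, c i • simplex (J i)) = ⊤) (j : Fin (r + 1)) :
    (graph J).Reachable (.inr j) (.inr 0) := by
  classical
  let ind (v : ι ⊕ Fin (r + 1)) : ℝ := if (graph J).Reachable v (.inr 0) then 0 else 1
  let f : (Fin r → ℝ) →ₗ[ℝ] ℝ := ∑ k : Fin r, ind (.inr k.succ) • LinearMap.proj k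
  have hf : ∀ j, f (vertex j) = ind (.inr j) :=
    Fin.cases (by simp [f, ind, vertex]) fun k ↦ by simp [f, vertex, Pi.single_apply]
  have hker := vectorSpan_sum_smul_simplex_le_ker (J := J) c (f := f) (φ := fun i ↦ ind (.inl i))
    fun i j hj ↦ by
      have hadj := (graph_adj_inl_inr.2 hj).reachable
      simp only [hf, ind, show (graph J).Reachable (.inr j) (.inr 0) ↔ _ from
        ⟨hadj.trans, hadj.symm.trans⟩]
  rw [hspan, top_le_iff, LinearMap.ker_eq_top] at hker
  by_contra hj
  simpa [hker, ind, hj] using hf j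

lemma isTree_graph (hc : ∀ i, c i ≠ 0) (hJ : ∀ i, (J i).Nonempty)
    (hspan : vectorSpan ℝ (∑ i, c i • simplex (J i)) = ⊤)
    (hdim : ∑ i, dim (c i • simplex (J i)) = r) : (graph J).IsTree := by
  have hreach : ∀ v, (graph J).Reachable v (.inr 0) := by
    rintro (i | j)
    · obtain ⟨j, hj⟩ := hJ i
      exact (graph_adj_inl_inr.2 hj).reachable.trans (reachable_of_vectorSpan_eq_top hspan j)
    · exact reachable_of_vectorSpan_eq_top hspan j
  refine isTree_iff_connected_and_card.2
    ⟨(connected_iff_exists_forall_reachable _).2 ⟨.inr 0, fun v ↦ (hreach v).symm⟩, ?_⟩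
  simp only [natCard_edgeSet_graph, ← fun i ↦ dim_smul_simplex_add_one (hc i) (hJ i),
    Finset.sum_add_distrib, hdim]
  simp only [Finset.sum_const, Finset.card_univ, smul_eq_mul, mul_one, Nat.card_eq_fintype_card,
    Fintype.card_sum, Fintype.card_fin]
  ring

lemma IsCoord.exists_mem_openSegment (hc : ∀ i, 0 < c i) {a : ι → Fin (r + 1) → ℝ}
    (ha : IsCoord J c a y) (hpos : ∀ i, ∀ j ∈ J i, 0 < a i j)
    (hx : x ∈ ∑ i, c i • simplex (J i)) :
    ∃ z ∈ ∑ i, c i • simplex (J i), y ∈ openSegment ℝ x z := by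
  obtain ⟨b, hb, -⟩ := (mem_sum_smul_simplex hc).1 hx
  have hlim (i : ι) (j : Fin (r + 1)) : Filter.Tendsto (fun δ ↦ a i j + δ * (a i j + -1 * b i j))
      (nhdsWithin 0 (Set.Ioi 0)) (nhds (a i j)) := by
    have hcont : Continuous fun δ ↦ a i j + δ * (a i j + -1 * b i j) := by fun_prop
    simpa using (hcont.tendsto 0).mono_left nhdsWithin_le_nhds
  have hev : ∀ᶠ δ : ℝ in nhdsWithin 0 (Set.Ioi 0), ∀ i, ∀ j, j ∈ J i →
      0 < a i j + δ * (a i j + -1 * b i j) := by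
    simp only [Filter.eventually_all]
    exact fun i j hj ↦ (hlim i j).eventually_const_lt (hpos i j hj)
  obtain ⟨δ, hδ, hδ0⟩ := (hev.and self_mem_nhdsWithin).exists
  refine ⟨y + δ • (y + (-1 : ℝ) • x), (mem_sum_smul_simplex hc).2
    ⟨a + δ • (a + (-1 : ℝ) • b), ?_, fun i j ↦ ?_⟩,
    δ / (1 + δ), 1 / (1 + δ), by positivity, by positivity, by field_simp; ring, ?_⟩
  · simpa using ha.add_smul (ha.add_smul hb (-1)) δ
  · by_cases hj : j ∈ J i
    · exact (hδ i j hj).le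
    · simp [ha.supp i j hj, hb.supp i j hj]
  · ext k
    simp only [Pi.add_apply, Pi.smul_apply, smul_eq_mul]
    field_simp
    ring

lemma IsCoord.eq_of_isExposed (hc : ∀ i, 0 < c i) {a : ι → Fin (r + 1) → ℝ}
    (ha : IsCoord J c a y) (hpos : ∀ i, ∀ j ∈ J i, 0 < a i j) {F : Set (Fin r → ℝ)}
    (hF : IsExposed ℝ (∑ i, c i • simplex (J i)) F) (hy : y ∈ F) :
    F = ∑ i, c i • simplex (J i) := by
  refine hF.subset.antisymm fun x hx ↦ ?_
  obtain ⟨z, hz, hxyz⟩ := ha.exists_mem_openSegment hc hpos hx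
  exact hF.isExtreme.left_mem_of_mem_openSegment hx hz hy hxyz

end MinkowskiSum

/-! ### Good lattice points -/

section Good

variable {r : ℕ} {ι : Type*} {J : ι → Set (Fin (r + 1))} {n : ι → ℕ} {p : Fin r → ℝ}

lemma isGoodSummandPoint_iff (hG : (graph J).IsAcyclic) {i : ι} {c : ℝ} (hc : 0 < c) :
    IsGoodSummandPoint J i c p ↔ IsLatticePoint p ∧ p ∈ c • simplex (J i) ∧
      ∀ j ∈ J i, ¬ IsRoot J i j → bary c p j ≠ 0 := by
  refine and_congr_right fun _ ↦ and_congr_right fun hp ↦ ?_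
  simp only [mem_smul_simplex_diff_singleton hc hp]
  by_cases h0 : 0 ∈ J i
  · have hroot (j : Fin (r + 1)) : IsRoot J i j ↔ j = 0 :=
      ⟨fun h ↦ h.eq hG (isRoot_zero h0), fun h ↦ h ▸ isRoot_zero h0⟩
    simp [h0, hroot]
  · simp [h0]

variable [Fintype ι]

/-- `p` is a good lattice point of the polytope `∑ i, c i • simplex (J i)`, regarded as a cell with
these summands. -/
def IsGoodSum (J : ι → Set (Fin (r + 1))) (c : ι → ℝ) (p : Fin r → ℝ) : Prop :=
  ∃ q : ι → Fin r → ℝ, p = ∑ i, q i ∧ ∀ i, IsGoodSummandPoint J i (c i) (q i)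

lemma isGoodSum_iff (hG : (graph J).IsTree) (hn : ∀ i, 0 < n i) {a : ι → Fin (r + 1) → ℤ}
    {z : Fin r → ℤ} (ha : IsCoord J (fun i ↦ (n i : ℤ)) a z) :
    IsGoodSum J (fun i ↦ n i) (fun k ↦ (z k : ℝ)) ↔
      ∀ i j, 0 ≤ a i j ∧ (j ∈ J i ∧ ¬ IsRoot J i j → a i j ≠ 0) := by
  have hn' (i : ι) : (0 : ℝ) < n i := Nat.cast_pos.2 (hn i)
  have ha' : IsCoord J (fun i ↦ (n i : ℝ)) (fun i j ↦ (a i j : ℝ)) (fun k ↦ (z k : ℝ)) := by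
    simpa using ha.intCast
  simp only [IsGoodSum, isGoodSummandPoint_iff hG.isAcyclic (hn' _)]
  constructor
  · rintro ⟨q, hzq, hq⟩ i j
    have hbary : ∀ i j, bary (n i) (q i) j = a i j := fun i j ↦ congrFun₂
      ((existsUnique_isCoord hG _ _).unique (hzq ▸ isCoord_bary hn' fun i ↦ (hq i).2.1) ha') i j
    obtain ⟨-, hqJ, hface⟩ := hq i
    refine ⟨?_, fun ⟨hj, hroot⟩ ↦ ?_⟩
    · simpa [hbary] using ((mem_smul_simplex (hn' i)).1 hqJ).1 j
    · simpa [hbary] using hface j hj hroot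
  · intro h
    have hbary (i : ι) : bary (n i) (fun k ↦ (a i k.succ : ℝ)) = fun j ↦ (a i j : ℝ) :=
      bary_of_sum_eq (ha'.row i)
    refine ⟨fun i k ↦ a i k.succ, ?_, fun i ↦ ⟨fun k ↦ ⟨_, rfl⟩, ?_, fun j hj hroot ↦ ?_⟩⟩
    · ext k
      rw [Finset.sum_apply, ha'.col]
    · rw [mem_smul_simplex (hn' i), hbary]
      exact ⟨fun j ↦ Int.cast_nonneg (h i j).1, ha'.supp i⟩
    · rw [hbary]
      exact Int.cast_ne_zero.2 ((h i j).2 ⟨hj, hroot⟩)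

/-- A point near the lattice point `p`, so close that `p` is good for a cell exactly when the cell
contains `perturb p`. The step is smaller than `1 / r` because `r` bounds the drift. -/
noncomputable def perturb (p : Fin r → ℝ) : Fin r → ℝ :=
  p + (r + 1 : ℝ)⁻¹ • (-1)

lemma IsDrift.isCoord_perturb {a b : ι → Fin (r + 1) → ℤ} (hb : IsDrift J b) {z : Fin r → ℤ}
    (ha : IsCoord J (fun i ↦ (n i : ℤ)) a z) :
    IsCoord J (fun i ↦ (n i : ℝ)) (fun i j ↦ a i j + (r + 1 : ℝ)⁻¹ * b i j)
      (perturb fun k ↦ (z k : ℝ)) := by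
  have hab := ha.intCast.add_smul hb.isCoord.intCast (r + 1 : ℝ)⁻¹
  have hrow : (fun i ↦ ((n i : ℤ) : ℝ)) + (r + 1 : ℝ)⁻¹ • (fun i ↦ ((0 : ι → ℤ) i : ℝ)) =
      fun i ↦ (n i : ℝ) := by ext; simp
  have hcol : (fun k ↦ (z k : ℝ)) + (r + 1 : ℝ)⁻¹ • (fun k ↦ ((-1 : Fin r → ℤ) k : ℝ)) =
      perturb fun k ↦ (z k : ℝ) := by ext; simp [perturb]
  rwa [hrow, hcol] at hab

lemma abs_inv_mul_lt_one {b : ℤ} (hb : |b| ≤ r) : |(r + 1 : ℝ)⁻¹ * b| < 1 := by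
  have hb' : |(b : ℝ)| ≤ r := mod_cast hb
  rw [abs_mul, abs_of_pos (by positivity), inv_mul_lt_one₀ (by positivity)]
  linarith

lemma add_inv_mul_pos {a b : ℤ} (hb : |b| ≤ r) (ha : 0 ≤ a) (hab : b ≤ 0 → a ≠ 0) :
    0 < a + (r + 1 : ℝ)⁻¹ * b := by
  rcases ha.eq_or_lt' with rfl | ha
  · have hb0 : 0 < b := not_le.1 fun h ↦ hab h rfl
    positivity
  · have ha' : (1 : ℝ) ≤ a := mod_cast ha
    linarith [(abs_lt.1 (abs_inv_mul_lt_one hb)).1]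

lemma add_inv_mul_nonneg_iff {a b : ℤ} (hb : |b| ≤ r) :
    0 ≤ a + (r + 1 : ℝ)⁻¹ * b ↔ 0 ≤ a ∧ (b < 0 → a ≠ 0) := by
  constructor
  · refine fun h ↦ ⟨?_, ?_⟩
    · have ha : ((-1 : ℤ) : ℝ) < a := by
        push_cast
        linarith [(abs_lt.1 (abs_inv_mul_lt_one hb)).2]
      exact Int.cast_lt.1 ha
    · rintro hb0 rfl
      rw [Int.cast_zero, zero_add, mul_nonneg_iff_of_pos_left (by positivity)] at h
      exact hb0.not_ge (mod_cast h)
  · rintro ⟨ha, hab⟩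
    rcases lt_or_ge b 0 with hb0 | hb0
    · exact (add_inv_mul_pos hb ha fun _ ↦ hab hb0).le
    · positivity

lemma IsDrift.neg_iff {b : ι → Fin (r + 1) → ℤ} (hb : IsDrift J b) (hG : (graph J).IsAcyclic)
    (i : ι) (j : Fin (r + 1)) : b i j < 0 ↔ j ∈ J i ∧ ¬ IsRoot J i j := by
  refine ⟨fun h ↦ ⟨?_, fun hroot ↦ (hb.nonneg_of_isRoot hG hroot).not_gt h⟩,
    fun ⟨hj, hroot⟩ ↦ hb.neg_of_not_isRoot i j hj hroot⟩
  by_contra hj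
  exact h.ne (hb.isCoord.supp i j hj)

lemma isGoodSum_iff_perturb_mem (hG : (graph J).IsTree) (hn : ∀ i, 0 < n i)
    (hp : IsLatticePoint p) :
    IsGoodSum J (fun i ↦ n i) p ↔ perturb p ∈ ∑ i, (n i : ℝ) • simplex (J i) := by
  choose z hz using hp
  obtain rfl : p = fun k ↦ (z k : ℝ) := funext hz
  obtain ⟨b, hb⟩ := exists_isDrift hG
  obtain ⟨a, ha⟩ := (existsUnique_isCoord hG (fun i ↦ (n i : ℤ)) z).exists
  rw [isGoodSum_iff hG hn ha, (hb.isCoord_perturb ha).mem_sum_smul_simplex_iff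
    (fun i ↦ Nat.cast_pos.2 (hn i)) hG]
  simp only [add_inv_mul_nonneg_iff (hb.abs_le _ _), hb.neg_iff hG.isAcyclic]

lemma IsGoodSum.exists_isCoord_perturb_pos (hp : IsGoodSum J (fun i ↦ n i) p)
    (hlat : IsLatticePoint p) (hG : (graph J).IsTree) (hn : ∀ i, 0 < n i) :
    ∃ a, IsCoord J (fun i ↦ (n i : ℝ)) a (perturb p) ∧ ∀ i, ∀ j ∈ J i, 0 < a i j := by
  choose z hz using hlat
  obtain rfl : p = fun k ↦ (z k : ℝ) := funext hz
  obtain ⟨b, hb⟩ := exists_isDrift hG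
  obtain ⟨a, ha⟩ := (existsUnique_isCoord hG (fun i ↦ (n i : ℤ)) z).exists
  rw [isGoodSum_iff hG hn ha] at hp
  refine ⟨_, hb.isCoord_perturb ha, fun i j hj ↦ ?_⟩
  refine add_inv_mul_pos (hb.abs_le i j) (hp i j).1 fun hbj ↦ ?_
  by_cases hroot : IsRoot J i j
  · have hsingle : ∀ j' ≠ j, a i j' = 0 := fun j' hj' ↦ ha.supp i j' fun hmem ↦
      (hb.pos_of_isRoot hG.isAcyclic hroot hmem hj').not_ge hbj
    have hrow := ha.row i
    rw [Fintype.sum_eq_single j hsingle] at hrow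
    exact hrow ▸ Nat.cast_ne_zero.2 (hn i).ne'
  · exact (hp i j).2 ⟨hj, hroot⟩

lemma IsGoodSum.eq_of_isExposed (hp : IsGoodSum J (fun i ↦ n i) p) (hlat : IsLatticePoint p)
    (hG : (graph J).IsTree) (hn : ∀ i, 0 < n i) {F : Set (Fin r → ℝ)}
    (hF : IsExposed ℝ (∑ i, (n i : ℝ) • simplex (J i)) F) (hpF : perturb p ∈ F) :
    F = ∑ i, (n i : ℝ) • simplex (J i) := by
  obtain ⟨a, ha, hpos⟩ := hp.exists_isCoord_perturb_pos hlat hG hn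
  exact ha.eq_of_isExposed (fun i ↦ Nat.cast_pos.2 (hn i)) hpos hF hpF

end Good

/-! ### Cells of fine mixed subdivisions -/

section Cell

variable {r : ℕ} {ι : Type*} {c : ι → ℝ} {K : ι → Set (Fin (r + 1))}
  {B : ι → Set (Fin r → ℝ)}

/-- For a Minkowski cell of `∑ i, c i • simplex (K i)` with summands `B i`, the sets of labels `J i`
with `B i = c i • simplex (J i)`. -/
def vertexLabels (c : ι → ℝ) (K : ι → Set (Fin (r + 1))) (B : ι → Set (Fin r → ℝ)) (i : ι) :
    Set (Fin (r + 1)) :=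
  {j | j ∈ K i ∧ c i • vertex j ∈ B i}

variable [Fintype ι]

lemma exists_subset_image_vertexLabels
    (hB : IsMinkowskiCell (fun i ↦ c i • simplex (K i)) B) (i : ι) :
    ∃ V ⊆ (fun j ↦ c i • vertex j) '' vertexLabels c K B i, V.Nonempty ∧ B i = convexHull ℝ V := by
  obtain ⟨V, hne, hV, hBV⟩ := hB.hull i
  refine ⟨V, fun v hv ↦ ?_, hne, hBV⟩
  have hvK := hV hv
  rw [smul_simplex_eq_convexHull] at hvK
  obtain ⟨j, hj, rfl⟩ := extremePoints_convexHull_subset hvK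
  exact ⟨j, ⟨hj, hBV ▸ subset_convexHull ℝ V hv⟩, rfl⟩

lemma nonempty_vertexLabels (hB : IsMinkowskiCell (fun i ↦ c i • simplex (K i)) B) (i : ι) :
    (vertexLabels c K B i).Nonempty := by
  obtain ⟨V, hV, hne, -⟩ := exists_subset_image_vertexLabels hB i
  exact (hne.mono hV).of_image

lemma eq_smul_simplex_vertexLabels (hB : IsMinkowskiCell (fun i ↦ c i • simplex (K i)) B)
    (i : ι) : B i = c i • simplex (vertexLabels c K B i) := by
  obtain ⟨V, hV, -, hBV⟩ := exists_subset_image_vertexLabels hB i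
  rw [smul_simplex_eq_convexHull]
  refine subset_antisymm (hBV.trans_subset (convexHull_mono hV)) (convexHull_min ?_ ?_)
  · rintro _ ⟨j, hj, rfl⟩
    exact hj.2
  · exact hBV ▸ convex_convexHull ℝ V

lemma sum_eq_sum_smul_simplex_vertexLabels
    (hB : IsMinkowskiCell (fun i ↦ c i • simplex (K i)) B) :
    ∑ i, B i = ∑ i, c i • simplex (vertexLabels c K B i) :=
  Finset.sum_congr rfl fun i _ ↦ eq_smul_simplex_vertexLabels hB i

lemma isTree_graph_vertexLabels (hc : ∀ i, c i ≠ 0)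
    (hB : IsMinkowskiCell (fun i ↦ c i • simplex (K i)) B)
    (hspan : vectorSpan ℝ (∑ i, c i • simplex (K i)) = ⊤)
    (hdim : ∑ i, dim (B i) = dim (∑ i, c i • simplex (K i))) :
    (graph (vertexLabels c K B)).IsTree := by
  have hr : dim (∑ i, c i • simplex (K i)) = r := by
    rw [dim, hspan, finrank_top, Module.finrank_fin_fun]
  refine isTree_graph hc (nonempty_vertexLabels hB) ?_ ?_
  · rw [← sum_eq_sum_smul_simplex_vertexLabels hB]
    refine Submodule.eq_top_of_finrank_eq ?_
    exact hB.full_dim.trans (hr.trans (Module.finrank_fin_fun ℝ).symm)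
  · simp only [← eq_smul_simplex_vertexLabels hB, hdim, hr]

lemma existsUnique_isGoodSum {n : ι → ℕ} (hn : ∀ i, 0 < n i) {S : Set (ι → Set (Fin r → ℝ))}
    (hS : IsFineMixedSubdivision (fun i ↦ (n i : ℝ) • simplex (K i)) S)
    (hspan : vectorSpan ℝ (∑ i, (n i : ℝ) • simplex (K i)) = ⊤) {p : Fin r → ℝ}
    (hlat : IsLatticePoint p) (hp : perturb p ∈ ∑ i, (n i : ℝ) • simplex (K i)) :
    ∃! B, B ∈ S ∧ IsGoodSum (vertexLabels (fun i ↦ n i) K B) (fun i ↦ n i) p := by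
  have hG : ∀ B ∈ S, (graph (vertexLabels (fun i ↦ n i) K B)).IsTree := fun B hB ↦
    isTree_graph_vertexLabels (fun i ↦ Nat.cast_ne_zero.2 (hn i).ne') (hS.cell B hB) hspan
      (hS.sum_dim B hB)
  have hsum : ∀ B ∈ S, ∑ i, B i = ∑ i, (n i : ℝ) • simplex (vertexLabels (fun i ↦ n i) K B i) :=
    fun B hB ↦ sum_eq_sum_smul_simplex_vertexLabels (hS.cell B hB)
  have hgood : ∀ B ∈ S, (IsGoodSum (vertexLabels (fun i ↦ n i) K B) (fun i ↦ n i) p ↔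
      perturb p ∈ ∑ i, B i) := fun B hB ↦ by
    rw [hsum B hB, isGoodSum_iff_perturb_mem (hG B hB) hn hlat]
  have hface : ∀ B ∈ S, ∀ F, IsExposed ℝ (∑ i, B i) F → perturb p ∈ F → F = ∑ i, B i := by
    intro B hB F hF hpF
    have hpB := (hgood B hB).2 (hF.subset hpF)
    rw [hsum B hB] at hF ⊢
    exact hpB.eq_of_isExposed hlat (hG B hB) hn hF hpF
  rw [← hS.cover, Set.mem_iUnion₂] at hp
  obtain ⟨B, hB, hpB⟩ := hp
  refine ⟨B, ⟨hB, (hgood B hB).2 hpB⟩, fun B' ⟨hB', hpB'⟩ ↦ hS.distinct hB' hB ?_⟩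
  obtain ⟨hF', hF⟩ := hS.common_face B' hB' B hB
  have hpF : perturb p ∈ (∑ i, B' i) ∩ ∑ i, B i := ⟨(hgood B' hB').1 hpB', hpB⟩
  exact (hface B' hB' _ hF' hpF).symm.trans (hface B hB _ hF hpF)

end Cell

lemma perturb_le {r : ℕ} (p : Fin r → ℝ) : perturb p ≤ p := by
  intro k
  have : (0 : ℝ) < (r + 1 : ℝ)⁻¹ := by positivity
  simp [perturb, this.le]

lemma IsLatticePoint.perturb_nonneg {r : ℕ} {p : Fin r → ℝ} (hlat : IsLatticePoint p)
    (hp : ∀ k, 0 < p k) : 0 ≤ perturb p := by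
  intro k
  obtain ⟨z, hz⟩ := hlat k
  have hone : (1 : ℝ) ≤ p k := by
    have hpos := hp k
    rw [hz] at hpos ⊢
    exact_mod_cast hpos
  have hinv : (r + 1 : ℝ)⁻¹ ≤ 1 := inv_le_one_of_one_le₀ (by simp)
  simpa [perturb] using hinv.trans hone

lemma zero_mem_withZero {r : ℕ} (I : Finset (Fin r)) : 0 ∈ withZero I :=
  Set.mem_insert _ _

lemma transversalhedron_eq_sum_summand {r : ℕ} {α : Type*} [DecidableEq α] [Fintype α]
    (A : Fin r → Finset α) : transversalhedron A = ∑ I, summand A I := by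
  refine (Fintype.sum_of_injective Subtype.val Subtype.val_injective _ _ (fun I hI ↦ ?_)
    fun _ ↦ rfl).symm
  have hmult : mult A I = 0 := by simpa using hI
  have hne : (simplex (withZero I)).Nonempty := .convexHull (.image _ ⟨0, zero_mem_withZero I⟩)
  rw [hmult, Nat.cast_zero, Set.zero_smul_set hne]

end Transversalhedron

open Transversalhedron MixedSubdivision

theorem mainTheorem4_general {ι : Type*} [Fintype ι] {r : ℕ} (n : ι → ℕ) (hn : ∀ i, 0 < n i)
    (K : ι → Set (Fin (r + 1))) (hK : ∀ i, 0 ∈ K i) (S : Set (ι → Set (Fin r → ℝ)))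
    (hS : IsFineMixedSubdivision (fun i ↦ (n i : ℝ) • simplex (K i)) S) (p : Fin r → ℝ)
    (hlat : IsLatticePoint p) (hp : p ∈ ∑ i, (n i : ℝ) • simplex (K i)) (hp0 : ∀ k, p k ≠ 0) :
    ∃! B, B ∈ S ∧ IsGoodSum (vertexLabels (fun i ↦ n i) K B) (fun i ↦ n i) p := by
  have hn' (i : ι) : (0 : ℝ) < n i := Nat.cast_pos.2 (hn i)
  have hpos (k : Fin r) : 0 < p k := by
    obtain ⟨a, ha, hnonneg⟩ := (mem_sum_smul_simplex hn').1 hp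
    exact (ha.col k ▸ Finset.sum_nonneg fun i _ ↦ hnonneg i _).lt_of_ne' (hp0 k)
  exact existsUnique_isGoodSum hn hS (vectorSpan_sum_smul_simplex_eq_top hn' hK hp hpos) hlat
    (mem_sum_smul_simplex_of_le hn' hK hp (hlat.perturb_nonneg hpos) (perturb_le p))

theorem mainTheorem4 {α : Type*} [DecidableEq α] [Fintype α] {r : ℕ}
    (M : Matroid α) (hr : M.eRank = r)
    (A : Fin r → Finset α) (hA : TransversalMatroid.IsPresentation M A)
    (S : Set (Transversalhedron.OccurringType A → Set (Fin r → ℝ)))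
    (hS : MixedSubdivision.IsFineMixedSubdivision (Transversalhedron.summand A) S)
    (p : Fin r → ℝ) (hlat : Transversalhedron.IsLatticePoint p)
    (hp : p ∈ Transversalhedron.transversalhedron A) (hp0 : ∀ k, p k ≠ 0) :
    ∃! B, B ∈ S ∧ Transversalhedron.IsGoodPoint A B p := by
  rw [transversalhedron_eq_sum_summand] at hp
  exact mainTheorem4_general (fun I : OccurringType A ↦ TransversalMatroid.mult A I.1)
    (fun I ↦ I.2) (fun I ↦ withZero I.1) (fun I ↦ zero_mem_withZero I.1) S hS p hlat hp hp0
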